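/- **Setting.** Let $\mathcal S$ be a compact metric space with a finite Borel measure $ds$ that charges every nonempty open set, let $\mathcal A\subset\mathbb R^n$ be compact with Lebesgue measure $da$ such that $\mathcal A\cap B(a,\delta)$ has positive volume for all $a\in\mathcal A$, $\delta>0$, and let $\mathcal H=\mathcal S\times\mathcal A$, $dh=ds\,da$. Consider a Markov decision process with bounded measurable reward $r$, transition kernel $p(\cdot\mid h)$, initial distribution $p_0$ and discount $\gamma\in[0,1)$. For a policy $\pi$ (a Markov kernel from $\mathcal S$ to $\mathcal A$) let $Q^\pi(h)$ be the expected discounted sum of rewards $\sum_t\gamma^t r(h_t)$ of the trajectory started at $h_0=h$, let $J^\pi=\mathbb E_{s\sim p_0,\,a\sim\pi(\cdot\mid s)}[Q^\pi(s,a)]$, $\Pi^*=\arg\max_\pi J^\pi$, $Q^*=\sup_\pi Q^\pi$ and $\mathcal T^*f(h)=r(h)+\gamma\,\mathbb E_{s'\sim p(\cdot\mid h)}[\max_{a'}f(s',a')]$. Let $(\hat Q_\omega)_{\omega\in\Omega}$ be bounded Lipschitz functions on $\mathcal H$. The *Boltzmann policy* of $\hat Q_\omega$ at temperature $\varepsilon>0$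 has density $\exp(\hat Q_\omega(s,a)/\varepsilon)\big/\int_{\mathcal A}\exp(\hat Q_\omega(s,a')/\varepsilon)\,da'$; at temperature $0$ it is the weak limit of these policies, state by state, as the temperature decreases to $0$, when that limit exists. Let $\mathcal T_\omega$ be a target operator, depending on $\omega$ and on the Boltzmann policy $\pi_\omega$, such that $\mathcal T_\omega\hat Q_\omega=\mathcal T^*\hat Q_\omega$ whenever $\pi_\omega$ is the zero-temperature Boltzmann policy of $\hat Q_\omega$. For fixed $c>0$ and $p\in[1,\infty)$ the *residual error* $\varepsilon_\omega\ge0$ is the least solution of the recursive definition $\varepsilon_\omega=\frac cp\|\mathcal T_\omega\hat Q_\omega-\hat Q_\omega\|_{L^p(dh)}^p$, where $\mathcal T_\omega$ is formed with the Boltzmann policy $\pi_\omega$ of $\hat Q_\omega$ at temperature $\varepsilon_\omega$; let $\Omega^c\subseteq\Omega$ be the set of $\omega$ for which a least solution exists. Let $d$ be a probability measure on $\mathcal S$ and $(\pi_\theta)_{\theta\in\Theta}$ a family of policies, at least one of which has finite differential entropy $\mathscr H(\pi_\theta(\cdot\mid s))$ for $d$-almost every $s$, with $d$-integrable values. The ELBO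 is $$\mathcal L(\omega,\theta)=\mathbb E_{s\sim d}\Big[\mathbb E_{a\sim\pi_\theta(\cdot\mid s)}\Big[\tfrac{\hat Q_\omega(s,a)}{\varepsilon_\omega}\Big]+\mathscr H(\pi_\theta(\cdot\mid s))\Big]\in[-\infty,\infty],$$ read, when $\varepsilon_\omega=0$, as the limit of the same expression as a positive temperature in place of $\varepsilon_\omega$ decreases to $0$. **Assumptions.** (Positivity) $0<Q^*(h)<\infty$ for all $h\in\mathcal H$. (Representability) $\hat Q_{\omega}=Q^*$ for some $\omega\in\Omega$. (Local smoothness) For every $\omega$ with $\hat Q_\omega=Q^*$ and every state $s$, the function $\hat Q_\omega(s,\cdot)$ has a unique maximiser over $\mathcal A$ and is $C^2$ in a neighbourhood of it. **Theorem 2 (Optimal Boltzmann Distributions as Optimal Policies).** Let $(\omega^*,\theta^*)$ maximise $\mathcal L$ over $\Omega^c\times\Theta$. Then $\varepsilon_{\omega^*}=0$; $\hat Q_{\omega^*}$ satisfies the optimal Bellman equation $\mathcal T^*\hat Q_{\omega^*}=\hat Q_{\omega^*}$; $\hat Q_{\omega^*}=Q^*$; and the Boltzmann policy $\pi_{\omega^*}$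 of $\hat Q_{\omega^*}$ at temperature $\varepsilon_{\omega^*}$ exists, is unique, is the greedy Dirac-delta policy $\pi_{\omega^*}(\cdot\mid s)=\delta_{\arg\max_{a}\hat Q_{\omega^*}(s,a)}$, and is optimal: $\pi_{\omega^*}\in\Pi^*$. -/

import Mathlib

open MeasureTheory ProbabilityTheory Filter Topology
open scoped ENNReal

namespace Virel

noncomputable section

section MDP

variable {S A : Type*} [MeasurableSpace S] [MeasurableSpace A]

/-- A discounted, infinite-horizon Markov decision process with state space `S` and action
space `A`: a bounded measurable reward, a transition kernel, an initial state distribution and a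
discount factor in `[0, 1)`. -/
structure MDP (S A : Type*) [MeasurableSpace S] [MeasurableSpace A] where
  reward : S × A → ℝ
  measurable_reward : Measurable reward
  bounded_reward : ∃ R : ℝ, ∀ h, |reward h| ≤ R
  trans : Kernel (S × A) S
  markov_trans : IsMarkovKernel trans
  init : Measure S
  prob_init : IsProbabilityMeasure init
  discount : ℝ
  discount_nonneg : 0 ≤ discount
  discount_lt_one : discount < 1

/-- A (stochastic, stationary) policy: a Markov kernel from states to actions. -/
def Policy (S A : Type*) [MeasurableSpace S] [MeasurableSpace A] : Type _ :=
  {κ : Kernel S A // IsMarkovKernel κ}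

/-- The distribution `π(· | s)` of the action taken in the state `s`. -/
def Policy.act (π : Policy S A) (s : S) : Measure A := π.1 s

/-- One step of the controlled process on state-action pairs: from `h`, draw `s' ∼ p(· | h)` and
then `a' ∼ π(· | s')`. -/
def stepKernel (M : MDP S A) (π : Policy S A) : Kernel (S × A) (S × A) :=
  M.trans ⊗ₖ Kernel.prodMkLeft (S × A) π.1

instance (M : MDP S A) (π : Policy S A) : IsMarkovKernel (stepKernel M π) := by
  have := M.markov_trans
  have := π.2
  unfold stepKernel
  infer_instance

/-- `stepKernel` as the law of the pair at time `t + 1` given the pairs up to time `t`. -/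
def historyKernel (M : MDP S A) (π : Policy S A) (t : ℕ) :
    Kernel (Π _ : Finset.Iic t, S × A) (S × A) :=
  (stepKernel M π).comap (fun x => x ⟨t, Finset.mem_Iic.2 le_rfl⟩) (measurable_pi_apply _)

instance (M : MDP S A) (π : Policy S A) (t : ℕ) : IsMarkovKernel (historyKernel M π t) := by
  unfold historyKernel
  infer_instance

/-- The law of the trajectory `(h₀, h₁, h₂, …)` of state-action pairs with `h₀ = h`, under the
policy `π` (Ionescu-Tulcea). -/
def trajectoryLaw (M : MDP S A) (π : Policy S A) (h : S × A) : Measure (ℕ → S × A) :=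
  Kernel.traj (X := fun _ => S × A) (historyKernel M π) 0 (fun _ => h)

/-- The action-value function `Q^π(h)`: the expected discounted sum of rewards along a trajectory
that starts in `h`. -/
def qValue (M : MDP S A) (π : Policy S A) (h : S × A) : ℝ :=
  ∫ τ, ∑' t : ℕ, M.discount ^ t * M.reward (τ t) ∂(trajectoryLaw M π h)

/-- The reinforcement learning objective `J^π = E_{s ∼ p₀, a ∼ π(· | s)} [Q^π(s, a)]`. -/
def objective (M : MDP S A) (π : Policy S A) : ℝ :=
  ∫ s, ∫ a, qValue M π (s, a) ∂(π.act s) ∂M.init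

/-- The set `Π*` of optimal policies, the maximisers of `J^π` over all policies. -/
def optimalPolicies (M : MDP S A) : Set (Policy S A) :=
  {π | ∀ π' : Policy S A, objective M π' ≤ objective M π}

/-- The optimal action-value function `Q*(h) = sup_π Q^π(h)`. -/
def optimalQ (M : MDP S A) (h : S × A) : ℝ :=
  ⨆ π : Policy S A, qValue M π h

/-- The optimal Bellman operator `T* f (h) = r(h) + γ E_{s' ∼ p(· | h)} [max_{a'} f(s', a')]`. -/
def optimalBellman (M : MDP S A) (f : S × A → ℝ) (h : S × A) : ℝ :=
  M.reward h + M.discount * ∫ s', ⨆ a', f (s', a') ∂(M.trans h)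

end MDP

section Boltzmann

variable {S A : Type*} [MeasurableSpace S] [MeasurableSpace A]

/-- The Boltzmann distribution of `g : A → ℝ` at temperature `t > 0`: the probability measure with
density `exp (g a / t) / ∫ exp (g a' / t) da'` with respect to the reference measure `da`. -/
def boltzmann (da : Measure A) (g : A → ℝ) (t : ℝ) : Measure A :=
  da.tilted (fun a => g a / t)

/-- `π` is the Boltzmann policy of `f` at temperature `ε ≥ 0`. At `ε > 0` every `π(· | s)` is the
Boltzmann distribution of `f(s, ·)`; at `ε = 0` it is the weak limit of these distributions as the
temperature decreases to `0`. -/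
def IsBoltzmannPolicy [TopologicalSpace A] (da : Measure A) (f : S × A → ℝ) (ε : ℝ)
    (π : Policy S A) : Prop :=
  (0 < ε ∧ ∀ s, π.act s = boltzmann da (fun a => f (s, a)) ε) ∨
  (ε = 0 ∧ ∀ s, ∀ φ : C(A, ℝ),
    Tendsto (fun t : ℝ => ∫ a, φ a ∂(boltzmann da (fun a => f (s, a)) t)) (𝓝[>] 0)
      (𝓝 (∫ a, φ a ∂(π.act s))))

/-- `π` is the greedy Dirac-delta policy of `f`: in every state `s`, the function `f(s, ·)` has a
unique maximiser and `π(· | s)` is the point mass there. -/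
def IsGreedyDirac (f : S × A → ℝ) (π : Policy S A) : Prop :=
  ∀ s, ∃ a₀, (∀ a, a ≠ a₀ → f (s, a) < f (s, a₀)) ∧ π.act s = Measure.dirac a₀

end Boltzmann

section Residual

variable {S A Ω : Type*} [MeasurableSpace S] [MeasurableSpace A] [TopologicalSpace A]

/-- The set of target operators. A target operator `T_ω` may depend on the parameter `ω` and on
the Boltzmann policy `π_ω`, so it is a map `T ω π` on functions. It is required that the optimal
Bellman operator is recovered at `Q_ω` when `π` is the zero-temperature limit of the Boltzmann
policies of `Q_ω`. -/
def targetOperators (M : MDP S A) (da : Measure A) (Q : Ω → S × A → ℝ) :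
    Set (Ω → Policy S A → (S × A → ℝ) → (S × A → ℝ)) :=
  {T | ∀ ω π, IsBoltzmannPolicy da (Q ω) 0 π → T ω π (Q ω) = optimalBellman M (Q ω)}

/-- `ε` solves the (recursive) definition of the residual error of `ω`:
`ε = (c / p) ‖T_ω Q_ω - Q_ω‖_p ^ p`, where `T_ω` is formed with the Boltzmann policy of `Q_ω` at
temperature `ε`. -/
def IsResidualError (da : Measure A) (dh : Measure (S × A)) (Q : Ω → S × A → ℝ)
    (T : Ω → Policy S A → (S × A → ℝ) → (S × A → ℝ)) (c p : ℝ) (ω : Ω) (ε : ℝ) : Prop :=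
  0 ≤ ε ∧ ∃ π : Policy S A, IsBoltzmannPolicy da (Q ω) ε π ∧
    ENNReal.ofReal ε = ENNReal.ofReal (c / p) *
      eLpNorm (fun h => T ω π (Q ω) h - Q ω h) (ENNReal.ofReal p) dh ^ p

/-- The constrained parameter set `Ω^c`: those `ω` whose residual error is defined, that is, for
which the recursive definition has a (least) solution. -/
def feasible (da : Measure A) (dh : Measure (S × A)) (Q : Ω → S × A → ℝ)
    (T : Ω → Policy S A → (S × A → ℝ) → (S × A → ℝ)) (c p : ℝ) : Set Ω :=
  {ω | ∃ ε, IsLeast {ε | IsResidualError da dh Q T c p ω ε} ε}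

/-- The residual error `ε_ω`: the least solution of its recursive definition (the only one, when
`T_ω` does not depend on the Boltzmann policy). -/
def residualError (da : Measure A) (dh : Measure (S × A)) (Q : Ω → S × A → ℝ)
    (T : Ω → Policy S A → (S × A → ℝ) → (S × A → ℝ)) (c p : ℝ) (ω : Ω) : ℝ :=
  sInf {ε | IsResidualError da dh Q T c p ω ε}

end Residual

section ELBO

variable {S A : Type*} [MeasurableSpace S] [MeasurableSpace A]

open scoped Classical in
/-- The differential entropy `-∫ log (dμ/da) dμ` of a probability measure `μ` with respect to a
finite measure `da`, as an extended real. It is `-∞` if `μ` has no density (a point mass, say), or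
if the integral diverges: its positive part is always finite. -/
def diffEntropy (da μ : Measure A) : EReal :=
  if μ ≪ da ∧ Integrable (llr μ da) μ then ((-∫ a, llr μ da a ∂μ : ℝ) : EReal) else ⊥

/-- The expectation of an extended-real-valued random variable: expectation of the positive part
minus expectation of the negative part. -/
def eexpect (d : Measure S) (g : S → EReal) : EReal :=
  ((∫⁻ s, (g s).toENNReal ∂d : ℝ≥0∞) : EReal) - ((∫⁻ s, (-g s).toENNReal ∂d : ℝ≥0∞) : EReal)

/-- The evidence lower bound at a temperature `t > 0`:
`E_{s ∼ d} [E_{a ∼ π(· | s)} [f(s, a) / t] + H(π(· | s))]`. -/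
def elboAt (da : Measure A) (d : Measure S) (f : S × A → ℝ) (t : ℝ) (π : Policy S A) : EReal :=
  eexpect d fun s => ((∫ a, f (s, a) / t ∂(π.act s) : ℝ) : EReal) + diffEntropy da (π.act s)

open scoped Classical in
/-- The evidence lower bound at a temperature `ε ≥ 0`; at `ε = 0` it is the limit of the values at
positive temperatures decreasing to `0`. -/
def elbo (da : Measure A) (d : Measure S) (f : S × A → ℝ) (ε : ℝ) (π : Policy S A) : EReal :=
  if ε = 0 then limsup (fun t : ℝ => elboAt da d f t π) (𝓝[>] 0) else elboAt da d f ε π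

/-- The policy `π` is non-deterministic in the sense that its differential entropy is finite for
`d`-almost every state and integrable. -/
def HasFiniteEntropy (da : Measure A) (d : Measure S) (π : Policy S A) : Prop :=
  (∀ᵐ s ∂d, diffEntropy da (π.act s) ≠ ⊥) ∧
    Integrable (fun s => (diffEntropy da (π.act s)).toReal) d

end ELBO

section Regularity

/-- The space of function approximators: every `Q_ω` is bounded and Lipschitz continuous. -/
def boundedLipschitz (Ω H : Type*) [PseudoEMetricSpace H] : Set (Ω → H → ℝ) :=
  {Q | ∀ ω, (∃ B : ℝ, ∀ h, |Q ω h| ≤ B) ∧ ∃ K, LipschitzWith K (Q ω)}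

/-- In every state `s`, the function `f(s, ·)` has a unique maximiser over the actions and is `C²`
in a neighbourhood of it (near a boundary point of the action set: the restriction of a `C²`
function). -/
def LocallySmoothMax {S : Type*} {n : ℕ} {A : Set (EuclideanSpace ℝ (Fin n))}
    (f : S × A → ℝ) : Prop :=
  ∀ s, ∃ a₀ : A, (∀ a, a ≠ a₀ → f (s, a) < f (s, a₀)) ∧
    ∃ Δ > 0, ∃ g : EuclideanSpace ℝ (Fin n) → ℝ,
      ContDiffOn ℝ 2 g (Metric.ball (a₀ : EuclideanSpace ℝ (Fin n)) Δ) ∧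
      ∀ a : A, (a : EuclideanSpace ℝ (Fin n)) ∈ Metric.ball (a₀ : EuclideanSpace ℝ (Fin n)) Δ →
        g a = f (s, a)

/-- Lebesgue measure `da` on a set of actions in `ℝⁿ`. -/
def actionVolume {n : ℕ} (A : Set (EuclideanSpace ℝ (Fin n))) : Measure A :=
  Measure.comap Subtype.val volume

end Regularity

end

end Virel

/-!
The argument has three parts.

*Dynamic programming.* The marginal laws of a trajectory are iterates of the transition operator
`P^π`, so that `Q^π = r + γ P^π Q^π` (`qValue_bellman`), and a bounded subsolution `f ≤ r + γ P^π f`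
lies below `Q^π` (`le_qValue_of_le_bellman`). If `Q*` has a measurable greedy policy `π`, then
`Q^{π'} ≤ T* Q* = r + γ P^π Q*` for every policy `π'`; hence `Q*` is a subsolution for `π`, which
gives `Q^π = Q*`, the optimality of `π` and `T* Q* = Q*`. Only unique maximisers and the continuity
of `Q*` are needed for this, not the regularity of the model.

*Zero temperature.* If a continuous `g` on a compact set has a unique maximiser, its Boltzmann
distributions converge weakly to the point mass there (`tendsto_integral_boltzmann`). The greedy
policy of `Q*` is therefore the zero-temperature Boltzmann policy, and the parameter representing
`Q*` has residual error `0`. Since `Q*` is bounded below by a positive constant, its evidence lower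
bound at a policy of finite entropy is `+∞` (`elbo_zero_eq_top`), whereas at a positive temperature
Gibbs' inequality bounds it away from `+∞` (`elboAt_lt_top`). A maximiser thus has residual error
`0`.

*Identification.* A zero residual error gives `T* Q = Q` only almost everywhere, and `T* Q` need not
be continuous. However, `|Q - Q*| = |T* Q - T* Q*| ≤ γ ‖Q - Q*‖` almost everywhere; the two ends of
this inequality are continuous, so it holds everywhere and forces `Q = Q*`
(`eq_of_optimalBellman_ae_eq`).
-/

namespace Virel

/-! ### Action values and the Bellman equation -/

section ActionValues

variable {S A : Type*} [MeasurableSpace S] [MeasurableSpace A]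

instance (M : MDP S A) (π : Policy S A) (h : S × A) :
    IsProbabilityMeasure (trajectoryLaw M π h) := by
  unfold trajectoryLaw
  infer_instance

instance (π : Policy S A) (s : S) : IsProbabilityMeasure (π.act s) :=
  π.2.isProbabilityMeasure s

/-- The transition operator `P^π` of the state-action process, acting on functions:
`(P^π f)(h) = E[f(h₁) | h₀ = h]`. -/
noncomputable def transitionOp (M : MDP S A) (π : Policy S A) (f : S × A → ℝ) (h : S × A) : ℝ :=
  ∫ x, f x ∂(stepKernel M π h)

variable (M : MDP S A) (π : Policy S A)

lemma integrable_of_measurable_of_bound {X : Type*} [MeasurableSpace X] {μ : Measure X}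
    [IsFiniteMeasure μ] {f : X → ℝ} {B : ℝ} (hf : Measurable f) (hB : ∀ x, |f x| ≤ B) :
    Integrable f μ :=
  Integrable.of_bound hf.aestronglyMeasurable B (Eventually.of_forall hB)

lemma abs_integral_le_of_bound {X : Type*} [MeasurableSpace X] {μ : Measure X}
    [IsProbabilityMeasure μ] {f : X → ℝ} {B : ℝ} (hB : ∀ x, |f x| ≤ B) :
    |∫ x, f x ∂μ| ≤ B := by
  simpa using norm_integral_le_of_norm_le_const (μ := μ) (f := f) (Eventually.of_forall hB)

lemma measurable_transitionOp {f : S × A → ℝ} (hf : Measurable f) :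
    Measurable (transitionOp M π f) :=
  (hf.stronglyMeasurable.integral_kernel (κ := stepKernel M π)).measurable

lemma abs_transitionOp_le {f : S × A → ℝ} {B : ℝ} (hB : ∀ x, |f x| ≤ B) (h : S × A) :
    |transitionOp M π f h| ≤ B :=
  abs_integral_le_of_bound hB

lemma transitionOp_eq {f : S × A → ℝ} {B : ℝ} (hf : Measurable f) (hB : ∀ x, |f x| ≤ B)
    (h : S × A) :
    transitionOp M π f h = ∫ s, ∫ a, f (s, a) ∂(π.act s) ∂(M.trans h) := by
  have := M.markov_trans
  have := π.2
  rw [transitionOp, stepKernel, ProbabilityTheory.integral_compProd]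
  · rfl
  · exact integrable_of_measurable_of_bound hf hB

lemma measurable_transitionOp_iterate {f : S × A → ℝ} (hf : Measurable f) (t : ℕ) :
    Measurable ((transitionOp M π)^[t] f) := by
  induction t with
  | zero => exact hf
  | succ t ih =>
    rw [Function.iterate_succ_apply']
    exact measurable_transitionOp M π ih

lemma abs_transitionOp_iterate_le {f : S × A → ℝ} {B : ℝ} (hB : ∀ x, |f x| ≤ B) (t : ℕ)
    (h : S × A) : |(transitionOp M π)^[t] f h| ≤ B := by
  induction t generalizing h with
  | zero => exact hB h
  | succ t ih =>
    rw [Function.iterate_succ_apply']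
    exact abs_transitionOp_le M π ih h

lemma integral_trajectoryLaw_zero {f : S × A → ℝ} (hf : Measurable f) (h : S × A) :
    ∫ τ, f (τ 0) ∂(trajectoryLaw M π h) = f h := by
  have e := Kernel.traj_map_frestrictLe_apply (X := fun _ => S × A) (κ := historyKernel M π) 0 0
    (fun _ => h)
  rw [Kernel.partialTraj_self, Kernel.id_apply] at e
  have hg : Measurable fun x : (Π _ : Finset.Iic 0, S × A) => f (x ⟨0, by simp⟩) :=
    hf.comp (measurable_pi_apply _)
  have := integral_map (μ := trajectoryLaw M π h)
    (Preorder.measurable_frestrictLe (X := fun _ => S × A) 0).aemeasurable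
    hg.aestronglyMeasurable
  rw [trajectoryLaw, e, integral_dirac' _ _ hg.stronglyMeasurable] at this
  exact this.symm

/-- The Markov property of the state-action process, for the marginal laws. -/
lemma integral_trajectoryLaw_succ {f : S × A → ℝ} {B : ℝ} (hf : Measurable f)
    (hB : ∀ x, |f x| ≤ B) (t : ℕ) (h : S × A) :
    ∫ τ, f (τ (t + 1)) ∂(trajectoryLaw M π h) =
      ∫ τ, transitionOp M π f (τ t) ∂(trajectoryLaw M π h) := by
  have hm : Measurable fun τ : ℕ → S × A => f (τ (t + 1)) := hf.comp (measurable_pi_apply _)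
  have key := Kernel.integral_traj_partialTraj (X := fun _ => S × A) (κ := historyKernel M π)
    (a := 0) (b := t) (Nat.zero_le t) (x₀ := fun _ => h) (f := fun τ => f (τ (t + 1)))
    (integrable_of_measurable_of_bound (μ := trajectoryLaw M π h) hm fun τ => hB _)
  refine key.symm.trans ?_
  rw [← Kernel.traj_map_frestrictLe_apply]
  have e : ∀ x : (Π _ : Finset.Iic t, S × A),
      ∫ y, f (y (t + 1)) ∂(Kernel.traj (X := fun _ => S × A) (historyKernel M π) t x) =
        transitionOp M π f (x ⟨t, Finset.mem_Iic.2 le_rfl⟩) := fun x => by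
    have e' := congrArg (fun k => k x)
      (Kernel.map_traj_succ_self (X := fun _ => S × A) (κ := historyKernel M π) (a := t))
    simp only [Kernel.map_apply _ (measurable_pi_apply (t + 1))] at e'
    rw [← integral_map (φ := fun y : ℕ → S × A => y (t + 1)) (measurable_pi_apply _).aemeasurable
      hf.aestronglyMeasurable, e']
    rfl
  simp_rw [e]
  have hg : Measurable fun x : (Π _ : Finset.Iic t, S × A) =>
      transitionOp M π f (x ⟨t, Finset.mem_Iic.2 le_rfl⟩) :=
    (measurable_transitionOp M π hf).comp (measurable_pi_apply _)
  exact integral_map (Preorder.measurable_frestrictLe (X := fun _ => S × A) t).aemeasurable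
    hg.aestronglyMeasurable

lemma integral_trajectoryLaw_eq_iterate {f : S × A → ℝ} {B : ℝ} (hf : Measurable f)
    (hB : ∀ x, |f x| ≤ B) (t : ℕ) (h : S × A) :
    ∫ τ, f (τ t) ∂(trajectoryLaw M π h) = (transitionOp M π)^[t] f h := by
  induction t generalizing f with
  | zero => exact integral_trajectoryLaw_zero M π hf h
  | succ t ih =>
    rw [integral_trajectoryLaw_succ M π hf hB,
      ih (measurable_transitionOp M π hf) (abs_transitionOp_le M π hB), Function.iterate_succ_apply]

/-- Exchange of expectation and discounted sum, for uniformly bounded summands. -/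
lemma integral_tsum_discount {X : Type*} [MeasurableSpace X] {μ : Measure X}
    [IsProbabilityMeasure μ] {γ B : ℝ} (h0 : 0 ≤ γ) (h1 : γ < 1) {F : ℕ → X → ℝ}
    (hF : ∀ t, Measurable (F t)) (hB : ∀ t x, |F t x| ≤ B) :
    ∫ x, ∑' t, γ ^ t * F t x ∂μ = ∑' t, γ ^ t * ∫ x, F t x ∂μ := by
  have hi : ∀ t, Integrable (fun x => γ ^ t * F t x) μ := fun t =>
    (integrable_of_measurable_of_bound (hF t) (hB t)).const_mul _
  rw [← integral_tsum_of_summable_integral_norm hi]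
  · simp_rw [integral_const_mul]
  · refine Summable.of_nonneg_of_le (fun t => integral_nonneg fun x => norm_nonneg _) (fun t => ?_)
      ((summable_geometric_of_lt_one h0 h1).mul_right B)
    refine (le_abs_self _).trans (abs_integral_le_of_bound fun x => ?_)
    rw [Real.norm_eq_abs, abs_abs, abs_mul, abs_of_nonneg (pow_nonneg h0 t)]
    exact mul_le_mul_of_nonneg_left (hB t x) (pow_nonneg h0 t)

lemma qValue_eq_tsum (h : S × A) :
    qValue M π h = ∑' t : ℕ, M.discount ^ t * (transitionOp M π)^[t] M.reward h := by
  obtain ⟨R, hR⟩ := M.bounded_reward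
  have e := integral_tsum_discount (μ := trajectoryLaw M π h) M.discount_nonneg M.discount_lt_one
    (F := fun t τ => M.reward (τ t)) (fun t => M.measurable_reward.comp (measurable_pi_apply t))
    (fun t τ => hR _)
  rw [qValue, e]
  simp_rw [integral_trajectoryLaw_eq_iterate M π M.measurable_reward hR]

lemma summable_qValue (h : S × A) :
    Summable fun t : ℕ => M.discount ^ t * (transitionOp M π)^[t] M.reward h := by
  obtain ⟨R, hR⟩ := M.bounded_reward
  refine Summable.of_norm_bounded
    ((summable_geometric_of_lt_one M.discount_nonneg M.discount_lt_one).mul_right R) fun t => ?_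
  rw [Real.norm_eq_abs, abs_mul, abs_of_nonneg (pow_nonneg M.discount_nonneg t)]
  exact mul_le_mul_of_nonneg_left (abs_transitionOp_iterate_le M π hR t h)
    (pow_nonneg M.discount_nonneg t)

lemma measurable_qValue : Measurable (qValue M π) := by
  have hlim : Tendsto (fun n h => ∑ t ∈ Finset.range n,
      M.discount ^ t * (transitionOp M π)^[t] M.reward h) atTop (𝓝 (qValue M π)) := by
    rw [tendsto_pi_nhds]
    intro h
    rw [qValue_eq_tsum]
    exact (summable_qValue M π h).hasSum.tendsto_sum_nat
  refine measurable_of_tendsto_metrizable (fun n => ?_) hlim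
  exact Finset.measurable_fun_sum _ fun t _ =>
    (measurable_transitionOp_iterate M π M.measurable_reward t).const_mul _

/-- Action values are bounded uniformly in the policy. -/
lemma exists_abs_qValue_le (M : MDP S A) : ∃ B : ℝ, ∀ π h, |qValue M π h| ≤ B := by
  obtain ⟨R, hR⟩ := M.bounded_reward
  refine ⟨∑' t : ℕ, M.discount ^ t * R, fun π h => abs_integral_le_of_bound fun τ => ?_⟩
  have hs : Summable fun t : ℕ => M.discount ^ t * R :=
    (summable_geometric_of_lt_one M.discount_nonneg M.discount_lt_one).mul_right R
  rw [← Real.norm_eq_abs]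
  refine tsum_of_norm_bounded hs.hasSum fun t => ?_
  rw [Real.norm_eq_abs, abs_mul, abs_of_nonneg (pow_nonneg M.discount_nonneg t)]
  exact mul_le_mul_of_nonneg_left (hR _) (pow_nonneg M.discount_nonneg t)

/-- The Bellman expectation equation `Q^π = r + γ P^π Q^π`. -/
lemma qValue_bellman (h : S × A) :
    qValue M π h = M.reward h + M.discount * transitionOp M π (qValue M π) h := by
  obtain ⟨R, hR⟩ := M.bounded_reward
  have e : transitionOp M π (qValue M π) h =
      ∑' t : ℕ, M.discount ^ t * (transitionOp M π)^[t + 1] M.reward h := by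
    simp_rw [transitionOp, qValue_eq_tsum]
    rw [integral_tsum_discount M.discount_nonneg M.discount_lt_one
      (measurable_transitionOp_iterate M π M.measurable_reward)
      (abs_transitionOp_iterate_le M π hR)]
    simp_rw [Function.iterate_succ_apply']
    rfl
  rw [e, qValue_eq_tsum, (summable_qValue M π h).tsum_eq_zero_add, ← tsum_mul_left]
  simp only [pow_zero, one_mul, Function.iterate_zero, id_eq, pow_succ']
  simp_rw [mul_assoc]

lemma transitionOp_mono {f g : S × A → ℝ} {B C : ℝ} (hf : Measurable f) (hB : ∀ x, |f x| ≤ B)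
    (hg : Measurable g) (hC : ∀ x, |g x| ≤ C) (hfg : ∀ x, f x ≤ g x) (h : S × A) :
    transitionOp M π f h ≤ transitionOp M π g h :=
  integral_mono (integrable_of_measurable_of_bound hf hB) (integrable_of_measurable_of_bound hg hC)
    hfg

/-- Comparison principle: a bounded subsolution of `f = r + γ P^π f` lies below `Q^π`. -/
lemma le_qValue_of_le_bellman {f : S × A → ℝ} {B : ℝ} (hf : Measurable f) (hB : ∀ x, |f x| ≤ B)
    (hle : ∀ h, f h ≤ M.reward h + M.discount * transitionOp M π f h) (h : S × A) :
    f h ≤ qValue M π h := by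
  obtain ⟨C, hC⟩ := exists_abs_qValue_le M
  have : Nonempty (S × A) := ⟨h⟩
  have hbdd : BddAbove (Set.range fun h => f h - qValue M π h) := by
    refine ⟨B + C, ?_⟩
    rintro _ ⟨x, rfl⟩
    have h1 := abs_le.1 (hB x)
    have h2 := abs_le.1 (hC π x)
    simp only
    linarith
  -- The supremum `m` of `f - Q^π` satisfies `m ≤ γ m`.
  set m := ⨆ h, (f h - qValue M π h) with hm
  have key : ∀ x, f x - qValue M π x ≤ M.discount * m := by
    intro x
    have h1 : transitionOp M π f x - transitionOp M π (qValue M π) x ≤ m := by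
      unfold transitionOp
      rw [← integral_sub (integrable_of_measurable_of_bound hf hB)
        (integrable_of_measurable_of_bound (measurable_qValue M π) (hC π))]
      refine (integral_mono ((integrable_of_measurable_of_bound hf hB).sub
        (integrable_of_measurable_of_bound (measurable_qValue M π) (hC π)))
        (integrable_const m) fun y => le_ciSup hbdd y).trans ?_
      simp
    have h2 := mul_le_mul_of_nonneg_left h1 M.discount_nonneg
    have h3 := hle x
    have h4 := qValue_bellman M π x
    linarith
  have hm' : m ≤ M.discount * m := ciSup_le key
  have hm0 : m ≤ 0 := by nlinarith [M.discount_lt_one]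
  linarith [le_ciSup hbdd h]

end ActionValues

/-! ### Optimality of the greedy policy -/

section Greedy

variable {S A : Type*} [MeasurableSpace S] [MeasurableSpace A] (M : MDP S A)

lemma bddAbove_qValue (h : S × A) : BddAbove (Set.range fun π => qValue M π h) := by
  obtain ⟨C, hC⟩ := exists_abs_qValue_le M
  exact ⟨C, by rintro _ ⟨π, rfl⟩; exact (abs_le.1 (hC π h)).2⟩

lemma qValue_le_optimalQ (π : Policy S A) (h : S × A) : qValue M π h ≤ optimalQ M h :=
  le_ciSup (bddAbove_qValue M h) π

lemma exists_abs_optimalQ_le [Nonempty (Policy S A)] : ∃ B : ℝ, ∀ h, |optimalQ M h| ≤ B := by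
  obtain ⟨C, hC⟩ := exists_abs_qValue_le M
  refine ⟨C, fun h => abs_le.2 ⟨?_, ciSup_le fun π => (abs_le.1 (hC π h)).2⟩⟩
  obtain ⟨π⟩ := ‹Nonempty (Policy S A)›
  exact (abs_le.1 (hC π h)).1.trans (qValue_le_optimalQ M π h)

lemma IsGreedyDirac.integral_act {f : S × A → ℝ} {π : Policy S A} (hπ : IsGreedyDirac f π)
    (hf : Measurable f) (s : S) : ∫ a, f (s, a) ∂(π.act s) = ⨆ a, f (s, a) := by
  obtain ⟨a₀, ha₀, hs⟩ := hπ s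
  have hle : ∀ a, f (s, a) ≤ f (s, a₀) := fun a => by
    rcases eq_or_ne a a₀ with rfl | h
    · exact le_rfl
    · exact (ha₀ a h).le
  have : Nonempty A := ⟨a₀⟩
  have hfs : Measurable fun a => f (s, a) := hf.comp measurable_prodMk_left
  rw [hs, integral_dirac' _ _ hfs.stronglyMeasurable]
  exact le_antisymm (le_ciSup (f := fun a => f (s, a)) ⟨_, by rintro _ ⟨a, rfl⟩; exact hle a⟩ a₀)
    (ciSup_le hle)

/-- The optimal Bellman operator is the Bellman operator of the greedy policy. -/
lemma IsGreedyDirac.optimalBellman_eq {f : S × A → ℝ} {π : Policy S A} (hπ : IsGreedyDirac f π)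
    {B : ℝ} (hf : Measurable f) (hB : ∀ x, |f x| ≤ B) (h : S × A) :
    optimalBellman M f h = M.reward h + M.discount * transitionOp M π f h := by
  rw [optimalBellman, transitionOp_eq M π hf hB]
  simp_rw [hπ.integral_act hf]

lemma IsGreedyDirac.integral_act_le {f : S × A → ℝ} {π : Policy S A} (hπ : IsGreedyDirac f π)
    {B : ℝ} (hf : Measurable f) (hB : ∀ x, |f x| ≤ B) (π' : Policy S A) (s : S) :
    ∫ a, f (s, a) ∂(π'.act s) ≤ ∫ a, f (s, a) ∂(π.act s) := by
  rw [hπ.integral_act hf]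
  refine (integral_mono (integrable_of_measurable_of_bound (hf.comp measurable_prodMk_left)
    fun a => hB (s, a)) (integrable_const (⨆ a, f (s, a))) fun a => ?_).trans (by simp)
  exact le_ciSup (f := fun a => f (s, a))
    ⟨B, by rintro _ ⟨a, rfl⟩; exact (abs_le.1 (hB (s, a))).2⟩ a

lemma measurable_integral_act {f : S × A → ℝ} (hf : Measurable f) (π : Policy S A) :
    Measurable fun s => ∫ a, f (s, a) ∂(π.act s) := by
  have := π.2
  exact (hf.stronglyMeasurable.integral_kernel_prod_right' (κ := π.1)).measurable

/-- The greedy policy of `Q*` attains `Q*`. As `Q^π = r + γ P^π Q^π ≤ T* Q*` for every `π`, the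
function `Q*` is a subsolution of the Bellman equation of its greedy policy. -/
theorem IsGreedyDirac.qValue_eq_optimalQ {π : Policy S A} (hπ : IsGreedyDirac (optimalQ M) π)
    (hm : Measurable (optimalQ M)) : qValue M π = optimalQ M := by
  have : Nonempty (Policy S A) := ⟨π⟩
  obtain ⟨B, hB⟩ := exists_abs_optimalQ_le M
  obtain ⟨C, hC⟩ := exists_abs_qValue_le M
  funext h
  refine le_antisymm (qValue_le_optimalQ M π h) (le_qValue_of_le_bellman M π hm hB (fun x => ?_) h)
  refine ciSup_le fun π' => ?_
  have hle : transitionOp M π' (qValue M π') x ≤ transitionOp M π (optimalQ M) x := by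
    have := M.markov_trans
    refine (transitionOp_mono M π' (measurable_qValue M π') (hC π') hm hB
      (qValue_le_optimalQ M π') x).trans ?_
    rw [transitionOp_eq M π' hm hB, transitionOp_eq M π hm hB]
    exact integral_mono
      (integrable_of_measurable_of_bound (measurable_integral_act hm π')
        fun s => abs_integral_le_of_bound fun a => hB (s, a))
      (integrable_of_measurable_of_bound (measurable_integral_act hm π)
        fun s => abs_integral_le_of_bound fun a => hB (s, a))
      fun s => hπ.integral_act_le hm hB π' s
  rw [qValue_bellman]
  linarith [mul_le_mul_of_nonneg_left hle M.discount_nonneg]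

theorem IsGreedyDirac.optimalBellman_optimalQ {π : Policy S A} (hπ : IsGreedyDirac (optimalQ M) π)
    (hm : Measurable (optimalQ M)) : optimalBellman M (optimalQ M) = optimalQ M := by
  have : Nonempty (Policy S A) := ⟨π⟩
  obtain ⟨B, hB⟩ := exists_abs_optimalQ_le M
  funext h
  rw [hπ.optimalBellman_eq M hm hB, ← hπ.qValue_eq_optimalQ M hm, ← qValue_bellman]

theorem IsGreedyDirac.mem_optimalPolicies {π : Policy S A} (hπ : IsGreedyDirac (optimalQ M) π)
    (hm : Measurable (optimalQ M)) : π ∈ optimalPolicies M := by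
  intro π'
  have : Nonempty (Policy S A) := ⟨π⟩
  have := M.prob_init
  obtain ⟨B, hB⟩ := exists_abs_optimalQ_le M
  obtain ⟨C, hC⟩ := exists_abs_qValue_le M
  unfold objective
  rw [hπ.qValue_eq_optimalQ M hm]
  refine integral_mono
    (integrable_of_measurable_of_bound (measurable_integral_act (measurable_qValue M π') π')
      fun s => abs_integral_le_of_bound fun a => hC π' (s, a))
    (integrable_of_measurable_of_bound (measurable_integral_act hm π)
      fun s => abs_integral_le_of_bound fun a => hB (s, a)) fun s => ?_
  refine le_trans ?_ (hπ.integral_act_le hm hB π' s)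
  exact integral_mono
    (integrable_of_measurable_of_bound ((measurable_qValue M π').comp measurable_prodMk_left)
      fun a => hC π' (s, a))
    (integrable_of_measurable_of_bound (hm.comp measurable_prodMk_left) fun a => hB (s, a))
    fun a => qValue_le_optimalQ M π' (s, a)

end Greedy

/-! ### Concentration of Boltzmann distributions at a unique maximiser -/

section Concentration

variable {A : Type*} [MetricSpace A] [CompactSpace A] [MeasurableSpace A] [BorelSpace A]

lemma integrable_of_continuous (μ : Measure A) [IsFiniteMeasure μ] {f : A → ℝ}
    (hf : Continuous f) : Integrable f μ :=
  hf.integrable_of_hasCompactSupport (HasCompactSupport.of_compactSpace f)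

/-- Laplace's principle: off any neighbourhood of the maximiser the Boltzmann density is at most
`exp (-δ / t) / da(V)`, where `V` is a neighbourhood on which `g` is within `δ` of its maximum. -/
theorem tendsto_integral_boltzmann (da : Measure A) [IsFiniteMeasure da] [da.IsOpenPosMeasure]
    {g φ : A → ℝ} (hg : Continuous g) (hφ : Continuous φ) {a₀ : A}
    (hmax : ∀ a, a ≠ a₀ → g a < g a₀) :
    Tendsto (fun t : ℝ => ∫ a, φ a ∂(boltzmann da g t)) (𝓝[>] 0) (𝓝 (φ a₀)) := by
  have : Nonempty A := ⟨a₀⟩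
  have hexp : ∀ t : ℝ, Integrable (fun a => Real.exp (g a / t)) da := fun t =>
    integrable_of_continuous da (by fun_prop)
  have hda : da ≠ 0 := fun h =>
    isOpen_univ.measure_ne_zero da Set.univ_nonempty (by simp [h])
  have hZ : ∀ t : ℝ, 0 < ∫ a, Real.exp (g a / t) ∂da := fun t => by
    have : NeZero da := ⟨hda⟩
    exact integral_exp_pos (hexp t)
  simp_rw [boltzmann, integral_tilted]
  have key := tendsto_setIntegral_peak_smul_of_integrableOn_of_tendsto (μ := da) (l := 𝓝[>] (0 : ℝ))
    (φ := fun t a => Real.exp (g a / t) / ∫ b, Real.exp (g b / t) ∂da) (g := φ) (x₀ := a₀)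
    (a := φ a₀) (s := Set.univ) (t := Set.univ) MeasurableSet.univ MeasurableSet.univ
    (Set.subset_univ _) univ_mem (measure_ne_top _ _)
    (Eventually.of_forall fun t a _ => (div_pos (Real.exp_pos _) (hZ t)).le) ?_ ?_ ?_
    (integrable_of_continuous da hφ).integrableOn (hφ.continuousAt.tendsto.mono_left inf_le_left)
  · simpa using key
  · intro u hu hau
    rcases (Set.univ \ u).eq_empty_or_nonempty with he | hne
    · rw [he]
      exact tendstoUniformlyOn_empty
    obtain ⟨b, hb, hbmax⟩ := (isClosed_univ.sdiff hu).isCompact.exists_isMaxOn hne hg.continuousOn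
    have hba : g b < g a₀ := hmax b fun h => hb.2 (h ▸ hau)
    set δ := (g a₀ - g b) / 2 with hδ
    have hδ0 : 0 < δ := by linarith
    set V := {a | g a₀ - δ < g a} with hV
    have hVo : IsOpen V := isOpen_lt continuous_const hg
    have hVpos : 0 < da.real V :=
      ENNReal.toReal_pos (hVo.measure_ne_zero da ⟨a₀, by simp [hV, hδ0]⟩) (measure_ne_top _ _)
    have hlim : Tendsto (fun t : ℝ => Real.exp (-δ * t⁻¹) / da.real V) (𝓝[>] 0) (𝓝 0) := by
      have h1 : Tendsto (fun t : ℝ => -δ * t⁻¹) (𝓝[>] 0) atBot :=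
        tendsto_inv_nhdsGT_zero.const_mul_atTop_of_neg (by linarith)
      simpa using (Real.tendsto_exp_atBot.comp h1).div_const (da.real V)
    rw [Metric.tendstoUniformlyOn_iff]
    intro e he
    filter_upwards [hlim.eventually (gt_mem_nhds he), self_mem_nhdsWithin] with t ht ht0 a ha
    have ht0 : 0 < t := ht0
    rw [Pi.zero_apply, dist_comm, Real.dist_0_eq_abs, abs_of_pos (div_pos (Real.exp_pos _) (hZ t))]
    refine lt_of_le_of_lt ?_ ht
    have hlow : Real.exp ((g a₀ - δ) / t) * da.real V ≤ ∫ b, Real.exp (g b / t) ∂da := by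
      calc Real.exp ((g a₀ - δ) / t) * da.real V
          = ∫ _ in V, Real.exp ((g a₀ - δ) / t) ∂da := by
            rw [setIntegral_const, smul_eq_mul, mul_comm]
        _ ≤ ∫ b in V, Real.exp (g b / t) ∂da := by
            refine setIntegral_mono_on (integrable_const _) (hexp t).integrableOn
              hVo.measurableSet fun x hx => ?_
            exact Real.exp_le_exp.2 (div_le_div_of_nonneg_right (le_of_lt hx) ht0.le)
        _ ≤ ∫ b, Real.exp (g b / t) ∂da :=
            setIntegral_le_integral (hexp t) (Eventually.of_forall fun _ => (Real.exp_pos _).le)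
    have hup : Real.exp (g a / t) ≤ Real.exp (-δ * t⁻¹) * Real.exp ((g a₀ - δ) / t) := by
      rw [← Real.exp_add]
      refine Real.exp_le_exp.2 ?_
      have : g a ≤ g b := hbmax ha
      rw [← div_eq_mul_inv, ← add_div]
      refine div_le_div_of_nonneg_right ?_ ht0.le
      linarith
    rw [div_le_div_iff₀ (hZ t) hVpos]
    calc Real.exp (g a / t) * da.real V
        ≤ Real.exp (-δ * t⁻¹) * Real.exp ((g a₀ - δ) / t) * da.real V := by gcongr
      _ = Real.exp (-δ * t⁻¹) * (Real.exp ((g a₀ - δ) / t) * da.real V) := by ring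
      _ ≤ _ := by gcongr
  · simp_rw [setIntegral_univ, integral_div, div_self (hZ _).ne']
    exact tendsto_const_nhds
  · refine Eventually.of_forall fun t => ?_
    exact Continuous.aestronglyMeasurable (by fun_prop)

end Concentration

/-! ### The zero-temperature Boltzmann policy -/

section ZeroTemperature

variable {S A : Type*} [MeasurableSpace S] [MetricSpace A] [MeasurableSpace A] [BorelSpace A]

/-- The maximiser is a measurable function of the state, because its graph is compact, so that the
states whose maximiser lies in a given closed set form a closed set. -/
theorem exists_isGreedyDirac [MetricSpace S] [CompactSpace S] [BorelSpace S] [CompactSpace A]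
    {f : S × A → ℝ} (hf : Continuous f)
    (hmax : ∀ s, ∃ a₀, ∀ a, a ≠ a₀ → f (s, a) < f (s, a₀)) :
    ∃ π : Policy S A, IsGreedyDirac f π := by
  choose m hm using hmax
  have hle : ∀ s a, f (s, a) ≤ f (s, m s) := fun s a => by
    rcases eq_or_ne a (m s) with rfl | h
    · exact le_rfl
    · exact (hm s a h).le
  have hmeas : Measurable m := by
    refine measurable_of_isClosed fun K hK => ?_
    have hcl : IsClosed {x : S × A | (∀ b, f (x.1, b) ≤ f x) ∧ x.2 ∈ K} := by
      have h1 : IsClosed {x : S × A | ∀ b, f (x.1, b) ≤ f x} := by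
        rw [Set.ofPred_forall]
        exact isClosed_iInter fun b => isClosed_le (by fun_prop) hf
      exact h1.inter (hK.preimage continuous_snd)
    have himg : m ⁻¹' K = Prod.fst '' {x : S × A | (∀ b, f (x.1, b) ≤ f x) ∧ x.2 ∈ K} := by
      ext s
      constructor
      · exact fun hs => ⟨(s, m s), ⟨hle s, hs⟩, rfl⟩
      · rintro ⟨⟨s', a⟩, ⟨h1, h2⟩, rfl⟩
        have : a = m s' := by
          by_contra h
          exact absurd (h1 (m s')) (not_le.2 (hm s' a h))
        simpa [← this] using h2
    rw [himg]
    exact (hcl.isCompact.image continuous_fst).isClosed.measurableSet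
  refine ⟨⟨Kernel.deterministic m hmeas, inferInstance⟩, fun s => ⟨m s, hm s, ?_⟩⟩
  exact Kernel.deterministic_apply hmeas s

theorem IsGreedyDirac.isBoltzmannPolicy [TopologicalSpace S] [CompactSpace A] (da : Measure A)
    [IsFiniteMeasure da] [da.IsOpenPosMeasure] {f : S × A → ℝ} (hf : Continuous f) {π : Policy S A}
    (hπ : IsGreedyDirac f π) : IsBoltzmannPolicy da f 0 π := by
  refine Or.inr ⟨rfl, fun s φ => ?_⟩
  obtain ⟨a₀, ha₀, hs⟩ := hπ s
  rw [hs, integral_dirac]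
  exact tendsto_integral_boltzmann da (by fun_prop) φ.continuous ha₀

/-- Weak limits of probability measures are unique. -/
theorem IsBoltzmannPolicy.eq_of_zero {da : Measure A} {f : S × A → ℝ} {π π' : Policy S A}
    (h : IsBoltzmannPolicy da f 0 π) (h' : IsBoltzmannPolicy da f 0 π') : π = π' := by
  rcases h with ⟨h0, _⟩ | ⟨_, h⟩
  · exact absurd h0 (lt_irrefl _)
  rcases h' with ⟨h0, _⟩ | ⟨_, h'⟩
  · exact absurd h0 (lt_irrefl _)
  refine Subtype.ext (Kernel.ext fun s => ?_)
  have e : π.act s = π'.act s := ext_of_forall_integral_eq_of_IsFiniteMeasure fun φ =>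
    tendsto_nhds_unique (h s φ.toContinuousMap) (h' s φ.toContinuousMap)
  exact e

end ZeroTemperature

/-! ### Fixed points of the optimal Bellman operator -/

section FixedPoint

lemma continuous_iSup_snd {S A : Type*} [TopologicalSpace S] [TopologicalSpace A]
    [CompactSpace A] {f : S × A → ℝ} (hf : Continuous f) :
    Continuous fun s => ⨆ a, f (s, a) := by
  have := IsCompact.continuous_sSup (f := fun s a => f (s, a)) (isCompact_univ (X := A)) hf
  simpa only [Set.image_univ, sSup_range] using this

variable {S A : Type*} [MetricSpace S] [MeasurableSpace S] [BorelSpace S]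
  [MetricSpace A] [CompactSpace A] [MeasurableSpace A]

lemma measurable_optimalBellman (M : MDP S A) {f : S × A → ℝ} (hf : Continuous f) :
    Measurable (optimalBellman M f) :=
  M.measurable_reward.add (((continuous_iSup_snd hf).stronglyMeasurable.integral_kernel
    (κ := M.trans)).measurable.const_mul _)

/-- The optimal Bellman operator is a `γ`-contraction for the supremum norm. -/
lemma abs_optimalBellman_sub_le [CompactSpace S] [Nonempty A] (M : MDP S A)
    {f g : S × A → ℝ} (hf : Continuous f) (hg : Continuous g) {m : ℝ} (hm : ∀ x, |f x - g x| ≤ m) (h : S × A) :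
    |optimalBellman M f h - optimalBellman M g h| ≤ M.discount * m := by
  have := M.markov_trans
  have hint : ∀ {u : S × A → ℝ}, Continuous u → Integrable (fun s => ⨆ a, u (s, a)) (M.trans h) :=
    fun hu => integrable_of_continuous _ (continuous_iSup_snd hu)
  have hsup : ∀ {u v : S × A → ℝ}, Continuous v → (∀ x, |u x - v x| ≤ m) → ∀ s,
      ⨆ a, u (s, a) ≤ (⨆ a, v (s, a)) + m := fun {u v} hv huv s => by
    refine ciSup_le fun a => ?_
    have hb : BddAbove (Set.range fun a => v (s, a)) :=
      (isCompact_range (hv.comp (Continuous.prodMk_right s))).bddAbove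
    have := le_ciSup hb a
    have := (abs_le.1 (huv (s, a))).2
    linarith
  have hsub : optimalBellman M f h - optimalBellman M g h =
      M.discount * ∫ s, ((⨆ a, f (s, a)) - ⨆ a, g (s, a)) ∂(M.trans h) := by
    rw [integral_sub (hint hf) (hint hg), optimalBellman, optimalBellman]
    ring
  rw [hsub, abs_mul, abs_of_nonneg M.discount_nonneg]
  refine mul_le_mul_of_nonneg_left (abs_integral_le_of_bound fun s => abs_le.2 ⟨?_, ?_⟩)
    M.discount_nonneg
  · linarith [hsup (u := g) hf (fun x => by rw [abs_sub_comm]; exact hm x) s]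
  · linarith [hsup (u := f) hg hm s]

/-- A continuous function that solves the optimal Bellman equation almost everywhere, for a measure
that charges every nonempty open set, equals any continuous exact solution: the contraction
estimate `|f - g| ≤ γ ‖f - g‖` holds almost everywhere, hence everywhere by continuity. No
continuity of the reward or of the transition kernel is involved. -/
theorem eq_of_optimalBellman_ae_eq [CompactSpace S] (M : MDP S A) (μ : Measure (S × A))
    [μ.IsOpenPosMeasure]
    {f g : S × A → ℝ} (hf : Continuous f) (hg : Continuous g)
    (hfe : optimalBellman M f =ᵐ[μ] f) (hge : optimalBellman M g = g) : f = g := by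
  rcases isEmpty_or_nonempty (S × A) with hE | hne
  · exact funext fun x => hE.elim x
  have hA : Nonempty A := hne.map Prod.snd
  have hcont : Continuous fun x => |f x - g x| := (hf.sub hg).abs
  obtain ⟨x₀, -, hx₀⟩ := isCompact_univ.exists_isMaxOn Set.univ_nonempty hcont.continuousOn
  have hmax : ∀ x, |f x - g x| ≤ |f x₀ - g x₀| := fun x => hx₀ (Set.mem_univ x)
  have hae : ∀ᵐ x ∂μ, |f x - g x| ≤ M.discount * |f x₀ - g x₀| := by
    filter_upwards [hfe] with x hx
    have := abs_optimalBellman_sub_le M hf hg hmax x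
    rwa [hx, hge] at this
  have hall : ∀ x, |f x - g x| ≤ M.discount * |f x₀ - g x₀| := by
    have hcl : IsClosed {x | |f x - g x| ≤ M.discount * |f x₀ - g x₀|} :=
      isClosed_le hcont continuous_const
    have := (Measure.dense_of_ae hae).closure_eq
    rw [hcl.closure_eq] at this
    exact fun x => Set.eq_univ_iff_forall.1 this x
  have h0 : |f x₀ - g x₀| ≤ 0 := by
    nlinarith [hall x₀, M.discount_lt_one, abs_nonneg (f x₀ - g x₀)]
  funext x
  have := (hmax x).trans h0
  exact sub_eq_zero.1 (abs_nonpos_iff.1 this)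

end FixedPoint

/-! ### Entropy and the evidence lower bound -/

section Entropy

variable {S A : Type*} [MeasurableSpace S] [MeasurableSpace A]

/-- Gibbs' inequality, in the crude form `H(μ) ≤ da(A)`. -/
lemma diffEntropy_le (da μ : Measure A) [IsFiniteMeasure da] [IsProbabilityMeasure μ] :
    diffEntropy da μ ≤ ((da.real Set.univ : ℝ) : EReal) := by
  unfold diffEntropy
  split_ifs with h
  · have := InformationTheory.integral_llr_add_sub_measure_univ_nonneg h.1 h.2
    rw [probReal_univ (μ := μ)] at this
    exact EReal.coe_le_coe_iff.2 (by linarith)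
  · exact bot_le

lemma eexpect_lt_top (d : Measure S) [IsProbabilityMeasure d] {g : S → EReal} {C : ℝ}
    (hg : ∀ s, g s ≤ (C : EReal)) : eexpect d g < ⊤ := by
  have hpos : ∫⁻ s, (g s).toENNReal ∂d ≤ ENNReal.ofReal C := by
    calc ∫⁻ s, (g s).toENNReal ∂d ≤ ∫⁻ _, ENNReal.ofReal C ∂d := by
          refine lintegral_mono fun s => ?_
          simpa using EReal.toENNReal_le_toENNReal (hg s)
      _ = ENNReal.ofReal C := by simp
  unfold eexpect
  rw [lt_top_iff_ne_top, sub_eq_add_neg]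
  refine EReal.add_ne_top ?_ ?_
  · rw [Ne, EReal.coe_ennreal_eq_top_iff]
    exact (hpos.trans_lt ENNReal.ofReal_lt_top).ne
  · rw [Ne, EReal.neg_eq_top_iff]
    exact EReal.coe_ennreal_ne_bot _

lemma le_eexpect (d : Measure S) {g : S → EReal} {u : S → ℝ} (hu : Integrable u d)
    (hug : ∀ᵐ s ∂d, (u s : EReal) ≤ g s) : ((∫ s, u s ∂d : ℝ) : EReal) ≤ eexpect d g := by
  have h1 : ∫⁻ s, ENNReal.ofReal (u s) ∂d ≤ ∫⁻ s, (g s).toENNReal ∂d := by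
    refine lintegral_mono_ae ?_
    filter_upwards [hug] with s hs
    simpa using EReal.toENNReal_le_toENNReal hs
  have h2 : ∫⁻ s, (-g s).toENNReal ∂d ≤ ∫⁻ s, ENNReal.ofReal (-u s) ∂d := by
    refine lintegral_mono_ae ?_
    filter_upwards [hug] with s hs
    have := EReal.toENNReal_le_toENNReal (EReal.neg_le_neg_iff.2 hs)
    simpa [← EReal.coe_neg] using this
  have hfin : ∀ {v : S → ℝ}, Integrable v d → ∫⁻ s, ENNReal.ofReal (v s) ∂d ≠ ⊤ := fun hv =>
    ((lintegral_mono fun s => Real.ofReal_le_enorm _).trans_lt hv.hasFiniteIntegral).ne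
  have f1 : ∫⁻ s, ENNReal.ofReal (u s) ∂d ≠ ⊤ := hfin hu
  have f2 : ∫⁻ s, ENNReal.ofReal (-u s) ∂d ≠ ⊤ := hfin hu.neg
  rw [integral_eq_lintegral_pos_part_sub_lintegral_neg_part hu, EReal.coe_sub, eexpect,
    EReal.coe_ennreal_toReal f1, EReal.coe_ennreal_toReal f2]
  exact EReal.sub_le_sub (EReal.coe_ennreal_le_coe_ennreal_iff.2 h1)
    (EReal.coe_ennreal_le_coe_ennreal_iff.2 h2)

theorem elboAt_lt_top (da : Measure A) [IsFiniteMeasure da] (d : Measure S)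
    [IsProbabilityMeasure d] {f : S × A → ℝ} {B : ℝ} (hB : ∀ x, |f x| ≤ B) {t : ℝ} (ht : 0 < t)
    (π : Policy S A) : elboAt da d f t π < ⊤ := by
  refine eexpect_lt_top d (C := B / t + da.real Set.univ) fun s => ?_
  rw [EReal.coe_add]
  refine add_le_add (EReal.coe_le_coe_iff.2 ?_) (diffEntropy_le da _)
  refine (le_abs_self _).trans (abs_integral_le_of_bound fun a => ?_)
  rw [abs_div, abs_of_pos ht]
  exact div_le_div_of_nonneg_right (hB _) ht.le

/-- A strictly positive reward term `f / t` forces the bound to `+∞` as `t` decreases to `0`, for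
every policy with finite entropy. -/
theorem elbo_zero_eq_top (da : Measure A) (d : Measure S) [IsProbabilityMeasure d]
    {f : S × A → ℝ} (hf : Measurable f) {B m : ℝ} (hB : ∀ x, |f x| ≤ B) (hm : 0 < m)
    (hmf : ∀ x, m ≤ f x) {π : Policy S A} (hπ : HasFiniteEntropy da d π) :
    elbo da d f 0 π = ⊤ := by
  rw [elbo, if_pos rfl]
  refine Tendsto.limsup_eq ?_
  have hlow : ∀ᶠ t : ℝ in 𝓝[>] 0,
      ((m * t⁻¹ + ∫ s, (diffEntropy da (π.act s)).toReal ∂d : ℝ) : EReal) ≤ elboAt da d f t π := by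
    filter_upwards [self_mem_nhdsWithin] with t ht
    have ht : 0 < t := ht
    have hint : Integrable (fun s => m * t⁻¹ + (diffEntropy da (π.act s)).toReal) d :=
      (integrable_const _).add hπ.2
    have := le_eexpect d (g := fun s => ((∫ a, f (s, a) / t ∂(π.act s) : ℝ) : EReal) +
      diffEntropy da (π.act s)) hint ?_
    · rwa [integral_add (integrable_const _) hπ.2, integral_const, probReal_univ, one_smul] at this
    filter_upwards [hπ.1] with s hs
    rw [EReal.coe_add]
    refine add_le_add (EReal.coe_le_coe_iff.2 ?_) (EReal.coe_toReal_le hs)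
    have hfs : Measurable fun a => f (s, a) := hf.comp measurable_prodMk_left
    refine le_trans (by simp) (integral_mono (integrable_const (m * t⁻¹))
      ((integrable_of_measurable_of_bound hfs fun a => hB (s, a)).div_const t) fun a => ?_)
    rw [div_eq_mul_inv]
    exact mul_le_mul_of_nonneg_right (hmf _) (inv_nonneg.2 ht.le)
  refine tendsto_nhds_top_mono ?_ hlow
  refine EReal.tendsto_coe_nhds_top_iff.2 (tendsto_atTop_add_const_right _ _ ?_)
  exact tendsto_inv_nhdsGT_zero.const_mul_atTop hm

end Entropy

/-! ### Lebesgue measure on a compact action set -/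

section ActionVolume

variable {n : ℕ} {A : Set (EuclideanSpace ℝ (Fin n))}

lemma isFiniteMeasure_actionVolume (hA : IsCompact A) : IsFiniteMeasure (actionVolume A) := by
  refine ⟨?_⟩
  rw [actionVolume, comap_subtype_coe_apply hA.measurableSet]
  exact (measure_mono (by simp)).trans_lt hA.measure_lt_top

lemma isOpenPosMeasure_actionVolume (hA : IsCompact A)
    (hvol : ∀ a ∈ A, ∀ δ > 0, 0 < volume (A ∩ Metric.ball a δ)) :
    (actionVolume A).IsOpenPosMeasure := by
  refine ⟨fun U hU ⟨a, ha⟩ => ?_⟩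
  obtain ⟨δ, hδ, hball⟩ := Metric.isOpen_iff.1 hU a ha
  rw [actionVolume, comap_subtype_coe_apply hA.measurableSet]
  refine ((hvol a a.2 δ hδ).trans_le (measure_mono ?_)).ne'
  rintro x ⟨hxA, hx⟩
  exact ⟨⟨x, hxA⟩, hball hx, rfl⟩

end ActionVolume

/-! ### The residual error -/

section Residual

variable {S A Ω : Type*} [MeasurableSpace S] [MeasurableSpace A] [TopologicalSpace A]
  {M : MDP S A} {da : Measure A} {dh : Measure (S × A)} {Q : Ω → S × A → ℝ}
  {T : Ω → Policy S A → (S × A → ℝ) → (S × A → ℝ)} {c p : ℝ} {ω : Ω}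

lemma isLeast_residualError (hω : ω ∈ feasible da dh Q T c p) :
    IsLeast {ε | IsResidualError da dh Q T c p ω ε} (residualError da dh Q T c p ω) := by
  obtain ⟨ε, hε⟩ := hω
  rwa [residualError, hε.csInf_eq]

/-- An exact solution of the optimal Bellman equation with a zero-temperature Boltzmann policy has
residual error `0`. -/
lemma isLeast_zero_of_optimalBellman_eq (hT : T ∈ targetOperators M da Q) (hp : 0 < p)
    {π : Policy S A} (hπ : IsBoltzmannPolicy da (Q ω) 0 π)
    (hQ : optimalBellman M (Q ω) = Q ω) :
    IsLeast {ε | IsResidualError da dh Q T c p ω ε} 0 := by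
  refine ⟨⟨le_rfl, π, hπ, ?_⟩, fun ε hε => hε.1⟩
  simp [hT ω π hπ, hQ, hp]

/-- A vanishing residual error means that the optimal Bellman equation holds almost everywhere. -/
lemma IsResidualError.optimalBellman_ae_eq (h : IsResidualError da dh Q T c p ω 0)
    (hT : T ∈ targetOperators M da Q) (hc : 0 < c) (hp : 0 < p)
    (hm : AEStronglyMeasurable (fun h => optimalBellman M (Q ω) h - Q ω h) dh) :
    optimalBellman M (Q ω) =ᵐ[dh] Q ω := by
  obtain ⟨-, π, hπ, h⟩ := h
  rw [hT ω π hπ, ENNReal.ofReal_zero] at h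
  have h1 : eLpNorm (fun h => optimalBellman M (Q ω) h - Q ω h) (ENNReal.ofReal p) dh = 0 := by
    rcases mul_eq_zero.1 h.symm with h | h
    · exact absurd h (ENNReal.ofReal_pos.2 (div_pos hc hp)).ne'
    · exact (ENNReal.rpow_eq_zero_iff_of_pos hp).1 h
  rw [eLpNorm_eq_zero_iff hm (ENNReal.ofReal_pos.2 hp).ne'] at h1
  filter_upwards [h1] with x hx
  exact sub_eq_zero.1 hx

end Residual

end Virel

theorem theorem2
    {S : Type*} [MetricSpace S] [CompactSpace S] [MeasurableSpace S] [BorelSpace S]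
    (ds : Measure S) [IsFiniteMeasure ds] [ds.IsOpenPosMeasure]
    {n : ℕ} (A : Set (EuclideanSpace ℝ (Fin n))) (hA : IsCompact A)
    (hA_vol : ∀ a ∈ A, ∀ δ > 0, 0 < volume (A ∩ Metric.ball a δ))
    (M : Virel.MDP S A)
    {Ω Θ : Type*}
    (Q : Ω → S × A → ℝ) (hQ : Q ∈ Virel.boundedLipschitz Ω (S × A))
    (T : Ω → Virel.Policy S A → (S × A → ℝ) → (S × A → ℝ))
    (hT : T ∈ Virel.targetOperators M (Virel.actionVolume A) Q)
    (c p : ℝ) (hc : 0 < c) (hp : 1 ≤ p)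
    (d : Measure S) [IsProbabilityMeasure d]
    (πvar : Θ → Virel.Policy S A)
    (hvar : ∃ θ, Virel.HasFiniteEntropy (Virel.actionVolume A) d (πvar θ))
    (hpos : ∀ h, 0 < Virel.optimalQ M h)
    (hrep : ∃ ω, Q ω = Virel.optimalQ M)
    (hsmooth : ∀ ω, Q ω = Virel.optimalQ M → Virel.LocallySmoothMax (Q ω))
    (ε : Ω → ℝ)
    (hε : ε = Virel.residualError (Virel.actionVolume A) (ds.prod (Virel.actionVolume A)) Q T c p)
    (Ωc : Set Ω)
    (hΩc : Ωc = Virel.feasible (Virel.actionVolume A) (ds.prod (Virel.actionVolume A)) Q T c p)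
    (L : Ω → Θ → EReal)
    (hL : L = fun ω θ => Virel.elbo (Virel.actionVolume A) d (Q ω) (ε ω) (πvar θ))
    (ωs : Ω) (θs : Θ) (hωs : ωs ∈ Ωc)
    (hmax : ∀ ω ∈ Ωc, ∀ θ, L ω θ ≤ L ωs θs) :
    ε ωs = 0 ∧
    Virel.optimalBellman M (Q ωs) = Q ωs ∧
    Q ωs = Virel.optimalQ M ∧
    ∃ π : Virel.Policy S A,
      Virel.IsBoltzmannPolicy (Virel.actionVolume A) (Q ωs) (ε ωs) π ∧
      (∀ π' : Virel.Policy S A,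
        Virel.IsBoltzmannPolicy (Virel.actionVolume A) (Q ωs) (ε ωs) π' → π' = π) ∧
      Virel.IsGreedyDirac (Q ωs) π ∧
      π ∈ Virel.optimalPolicies M := by
  have hAc : CompactSpace A := isCompact_iff_compactSpace.1 hA
  have hfin := Virel.isFiniteMeasure_actionVolume hA
  have hop := Virel.isOpenPosMeasure_actionVolume hA hA_vol
  have hcont : ∀ ω, Continuous (Q ω) := fun ω => (hQ ω).2.elim fun _ h => h.continuous
  have hp0 : 0 < p := one_pos.trans_le hp
  obtain ⟨ω₀, hω₀⟩ := hrep
  obtain ⟨θ₀, hθ₀⟩ := hvar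
  have hQc : Continuous (Virel.optimalQ M) := hω₀ ▸ hcont ω₀
  obtain ⟨π, hπ⟩ := Virel.exists_isGreedyDirac hQc fun s => by
    obtain ⟨a₀, ha₀, -⟩ := hsmooth ω₀ hω₀ s
    exact ⟨a₀, hω₀ ▸ ha₀⟩
  have hB := hπ.isBoltzmannPolicy (Virel.actionVolume A) hQc
  have hbell := hπ.optimalBellman_optimalQ M hQc.measurable
  -- The parameter that represents `Q*` is feasible with residual error `0` and infinite bound.
  have hleast := Virel.isLeast_zero_of_optimalBellman_eq (c := c) (ω := ω₀)
    (dh := ds.prod (Virel.actionVolume A)) hT hp0 (by rwa [hω₀]) (by rwa [hω₀])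
  have hε₀ : ε ω₀ = 0 := by rw [hε, Virel.residualError, hleast.csInf_eq]
  have htop : L ω₀ θ₀ = ⊤ := by
    obtain ⟨B, hBd⟩ := (hQ ω₀).1
    obtain ⟨s⟩ : Nonempty S := nonempty_of_isProbabilityMeasure d
    obtain ⟨a, -⟩ := hπ s
    obtain ⟨x, -, hx⟩ := isCompact_univ.exists_isMinOn ⟨(s, a), Set.mem_univ _⟩
      (hcont ω₀).continuousOn
    rw [hL]
    simp only [hε₀]
    refine Virel.elbo_zero_eq_top _ d (hcont ω₀).measurable hBd (m := Q ω₀ x) ?_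
      (fun y => hx (Set.mem_univ y)) hθ₀
    rw [hω₀]
    exact hpos x
  have hLs : L ωs θs = ⊤ := top_le_iff.1 (htop ▸ hmax ω₀ (hΩc ▸ ⟨0, hleast⟩) θ₀)
  have hres := Virel.isLeast_residualError (hΩc ▸ hωs)
  rw [← hε] at hres
  -- At a positive temperature the bound is finite.
  have hεs : ε ωs = 0 := by
    by_contra hne
    obtain ⟨B, hBd⟩ := (hQ ωs).1
    have := Virel.elboAt_lt_top (Virel.actionVolume A) d hBd (lt_of_le_of_ne hres.1.1 (Ne.symm hne))
      (πvar θs)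
    rw [hL] at hLs
    simp only [Virel.elbo, if_neg hne] at hLs
    exact this.ne hLs
  have hae := (hεs ▸ hres.1 : Virel.IsResidualError _ _ _ _ _ _ _ 0).optimalBellman_ae_eq hT hc hp0
    ((Virel.measurable_optimalBellman M (hcont ωs)).sub (hcont ωs).measurable).aestronglyMeasurable
  have hQs : Q ωs = Virel.optimalQ M :=
    Virel.eq_of_optimalBellman_ae_eq M _ (hcont ωs) hQc hae hbell
  rw [hεs, hQs]
  exact ⟨rfl, hbell, rfl, π, hB, fun π' h' => h'.eq_of_zero hB, hπ,
    hπ.mem_optimalPolicies M hQc.measurable⟩
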